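/- An occurrence of a pattern $q\in S_k$ in a permutation $p=p_1\cdots p_n$ is a choice of positions $i_1<\dots<i_k$ such that $p_{i_1},\dots,p_{i_k}$ are in the same relative order as $q_1,\dots,q_k$; $p$ avoids $q$ if there is no such occurrence. A permutation $p$ of length $n$ is (skew-)decomposable if there is $k$ with $1\le k\le n-1$ such that $p_i>p_j$ for all $i\le k<j$, and indecomposable otherwise. Let $\mathrm{Av}_n^*(123)$ be the set of indecomposable $123$-avoiding permutations of length $n$, and let $a_n^*$ be the total number of occurrences of $213$ in all permutations in $\mathrm{Av}_n^*(123)$. Let $C(x)=\sum_{n\ge 0}\frac{1}{n+1}\binom{2n}{n}x^n$. Then, as formal power series, $$\sum_{n\ge 0}a_n^*x^n=\frac{x^3C(x)}{(1-4x)^{3/2}}=\frac{x^2}{2(1-4x)^{3/2}}-\frac{x^2}{2(1-4x)}.$$ Moreover, $a_{m+2}^*=\frac{2m+1}{2}\binom{2m}{m}-\frac{4^m}{2}$ for all $m\ge 0$ (the sequence $0,1,7,38,187,874,\dots$, OEIS A000531). -/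

import Mathlib

namespace PatternCount

/-- `occurrences q p` is the set of occurrences of the pattern `q` in the permutation `p`
(`p i` is the entry in position `i`): strictly increasing choices `e` of positions of `p` at which
the entries of `p` are in the same relative order as the entries of `q`. -/
def occurrences {k n : ℕ} (q : Equiv.Perm (Fin k)) (p : Equiv.Perm (Fin n)) :
    Finset (Fin k → Fin n) :=
  Finset.univ.filter fun e =>
    (∀ i j, i < j → e i < e j) ∧ ∀ i j, p (e i) < p (e j) ↔ q i < q j

/-- The number of occurrences of `q` in `p` as a pattern. -/
def num {k n : ℕ} (q : Equiv.Perm (Fin k)) (p : Equiv.Perm (Fin n)) : ℕ :=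
  (occurrences q p).card

/-- The total number of occurrences of `q` in the permutations of a finite set `S`. -/
def totalNum {k n : ℕ} (q : Equiv.Perm (Fin k)) (S : Finset (Equiv.Perm (Fin n))) : ℕ :=
  ∑ p ∈ S, num q p

/-- The pattern `123`. -/
def pat123 : Equiv.Perm (Fin 3) := 1

/-- The pattern `213`, with one-line notation `1, 0, 2` on `Fin 3 = {0, 1, 2}`. -/
def pat213 : Equiv.Perm (Fin 3) := Equiv.swap 0 1

/-- The permutation `p` avoids the pattern `q`. -/
abbrev Avoids {k n : ℕ} (q : Equiv.Perm (Fin k)) (p : Equiv.Perm (Fin n)) : Prop :=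
  occurrences q p = ∅

/-- `p` is (skew-)decomposable: for some `0 < k < n`, each of the first `k` entries is larger than
each of the remaining `n - k` entries. -/
abbrev Decomposable {n : ℕ} (p : Equiv.Perm (Fin n)) : Prop :=
  ∃ k < n, 0 < k ∧ ∀ i j : Fin n, (i : ℕ) < k → k ≤ (j : ℕ) → p j < p i

/-- The indecomposable permutations of length `n` that avoid `123`. -/
def indecAv123 (n : ℕ) : Finset (Equiv.Perm (Fin n)) :=
  Finset.univ.filter fun p => Avoids pat123 p ∧ ¬ Decomposable p

/-- The generating function, by length, of the total number of `213` patterns in the indecomposable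
`123`-avoiding permutations. -/
noncomputable def genFun213 : PowerSeries ℚ :=
  PowerSeries.mk fun n => (totalNum pat213 (indecAv123 n) : ℚ)

/-- The generating function of the Catalan numbers, with rational coefficients. -/
noncomputable def catalanGF : PowerSeries ℚ :=
  PowerSeries.map (Nat.castRingHom ℚ) PowerSeries.catalanSeries

/-- The formal power series `(1 - 4 X) ^ a = ∑ n, choose a n * (-4 X) ^ n`. -/
noncomputable def oneSubFourXPow (a : ℚ) : PowerSeries ℚ :=
  PowerSeries.rescale (-4 : ℚ) (PowerSeries.binomialSeries ℚ a)

end PatternCount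

/-!
Permutations are built by appending last entries. Appending `v` (counted from `0`) to a
`123`-avoiding permutation creates no `123` when no entry below `v` exceeds an earlier one, and then
creates `choose v 2` occurrences of `213`, since the `v` smaller entries are in decreasing order.

Let `L h` and `T h` be the generating functions of the permutations that become indecomposable
`123`-avoiders when a last entry `h` is appended, where `T h` weights them by their number of `213`
patterns. The series wanted is `T 1`, and recording the last entry of these permutations gives
`L (h + 1) = L (h + 2) + x L h` and
`T (h + 1) = T (h + 2) + x T h + x * choose (h + 1) 2 * L (h + 1)`.
In terms of the shift `E`, the operator `E ^ 2 - E + x` factors as `(E - x C) (E - 1 / C)`, and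
`E - 1 / C` is injective on sequences whose term `h` is divisible by `x ^ h`. Hence
`L h = (x C) ^ h` and, with `y = x C ^ 2`,
`T 1 = x * ∑ i, choose (i + 1) 2 * y ^ (i + 1) = x y ^ 2 / (1 - y) ^ 3`.
The result follows from `1 - y = C * sqrt (1 - 4 x)`.
-/

namespace PatternCount

open Finset PowerSeries

section Append

variable {n : ℕ}

/-- Append a last entry of value `v` to `q`, raising by one the entries that are at least `v`. -/
def snocPerm (v : Fin (n + 1)) (q : Equiv.Perm (Fin n)) : Equiv.Perm (Fin (n + 1)) :=
  (finSuccEquiv' (Fin.last n)).trans ((Equiv.optionCongr q).trans (finSuccEquiv' v).symm)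

@[simp]
theorem snocPerm_castSucc (v : Fin (n + 1)) (q : Equiv.Perm (Fin n)) (i : Fin n) :
    snocPerm v q i.castSucc = v.succAbove (q i) := by
  rw [← Fin.succAbove_last]
  simp [snocPerm, -Fin.succAbove_last]

@[simp]
theorem snocPerm_last (v : Fin (n + 1)) (q : Equiv.Perm (Fin n)) :
    snocPerm v q (Fin.last n) = v := by
  simp [snocPerm]

theorem snocPerm_bijective (n : ℕ) :
    Function.Bijective fun x : Fin (n + 1) × Equiv.Perm (Fin n) => snocPerm x.1 x.2 := by
  rw [Fintype.bijective_iff_injective_and_card]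
  refine ⟨?_, by simp [Fintype.card_perm, Nat.factorial_succ]⟩
  rintro ⟨v, q⟩ ⟨w, r⟩ h
  obtain rfl : v = w := by simpa using congrArg (· (Fin.last n)) h
  obtain rfl : q = r := by
    ext1 i
    simpa using congrArg (· i.castSucc) h
  rfl

theorem snocPerm_castSucc_lt_last_iff (v : Fin (n + 1)) (q : Equiv.Perm (Fin n)) (i : Fin n) :
    snocPerm v q i.castSucc < snocPerm v q (Fin.last n) ↔ (q i : ℕ) < v := by
  rw [snocPerm_castSucc, snocPerm_last, Fin.succAbove_lt_iff_castSucc_lt]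
  rfl

theorem lt_snocPerm_castSucc_iff (v : Fin (n + 1)) (q : Equiv.Perm (Fin n)) (i : Fin n) :
    v < snocPerm v q i.castSucc ↔ (v : ℕ) ≤ q i := by
  rw [snocPerm_castSucc, Fin.lt_succAbove_iff_le_castSucc]
  rfl

theorem snocPerm_castSucc_lt_castSucc_iff (v : Fin (n + 1)) (q : Equiv.Perm (Fin n))
    (i j : Fin n) : snocPerm v q i.castSucc < snocPerm v q j.castSucc ↔ q i < q j := by
  rw [snocPerm_castSucc, snocPerm_castSucc, Fin.succAbove_lt_succAbove_iff]

end Append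

section Avoidance

variable {n : ℕ}

theorem avoids_pat123_iff (p : Equiv.Perm (Fin n)) :
    Avoids pat123 p ↔ ∀ i j k, i < j → j < k → p i < p j → ¬ p j < p k := by
  unfold Avoids occurrences
  rw [filter_eq_empty_iff]
  constructor
  · intro h i j k hij hjk hpij hpjk
    have hik := hij.trans hjk
    have hpik := hpij.trans hpjk
    refine h (mem_univ ![i, j, k]) ⟨fun a b hab => ?_, fun a b => ?_⟩
    · fin_cases a <;> fin_cases b <;> simp_all
    · fin_cases a <;> fin_cases b <;> simp [pat123, *, le_of_lt]
  · rintro h e - ⟨hpos, hval⟩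
    exact h (e 0) (e 1) (e 2) (hpos _ _ (by decide)) (hpos _ _ (by decide))
      ((hval _ _).2 (by decide)) ((hval _ _).2 (by decide))

/-- Every entry that exceeds some earlier entry is at least `h`: exactly then an entry `h` can be
appended without becoming the last letter of a `123`. -/
def AscentTopsGE (p : Equiv.Perm (Fin n)) (h : ℕ) : Prop :=
  ∀ i j, i < j → p i < p j → h ≤ p j

theorem avoids_pat123_snocPerm_iff (v : Fin (n + 1)) (q : Equiv.Perm (Fin n)) :
    Avoids pat123 (snocPerm v q) ↔ Avoids pat123 q ∧ AscentTopsGE q v := by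
  have hlast (i : Fin (n + 1)) : ¬ Fin.last n < i := (Fin.le_last i).not_gt
  simp only [avoids_pat123_iff, AscentTopsGE, Fin.forall_fin_succ', Fin.castSucc_lt_castSucc_iff,
    Fin.castSucc_lt_last, snocPerm_castSucc_lt_castSucc_iff, snocPerm_castSucc_lt_last_iff, hlast,
    false_imp_iff, true_imp_iff, imp_true_iff, and_true]
  simp only [forall_and, not_lt]

theorem ascentTopsGE_snocPerm_zero_iff (q : Equiv.Perm (Fin n)) (h : ℕ) :
    AscentTopsGE (snocPerm 0 q) (h + 1) ↔ AscentTopsGE q h := by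
  simp [AscentTopsGE, Fin.forall_fin_succ', Fin.le_last, not_lt]

theorem ascentTopsGE_snocPerm_iff {v : Fin (n + 1)} {q : Equiv.Perm (Fin n)} {h : ℕ}
    (hv : 0 < (v : ℕ)) (hq : AscentTopsGE q v) : AscentTopsGE (snocPerm v q) h ↔ h ≤ v := by
  constructor
  · intro hs
    have hn : 0 < n := by omega
    have hlt := (snocPerm_castSucc_lt_last_iff v q (q.symm ⟨0, hn⟩)).2 (by simpa using hv)
    simpa using hs _ _ (Fin.castSucc_lt_last _) hlt
  · intro hhv i j hij hlt
    induction j using Fin.lastCases with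
    | last => simpa using hhv
    | cast j =>
      induction i using Fin.lastCases with
      | last => exact absurd hij (Fin.le_last _).not_gt
      | cast i =>
        have hle := hq i j hij (by simpa using hlt)
        exact hhv.trans ((lt_snocPerm_castSucc_iff v q j).2 hle).le

/-- The positions of the smaller entries to the left of position `k`. -/
def smallerBefore (p : Equiv.Perm (Fin n)) (k : Fin n) : Finset (Fin n) :=
  {i | i < k ∧ p i < p k}

theorem mem_smallerBefore {p : Equiv.Perm (Fin n)} {i k : Fin n} :
    i ∈ smallerBefore p k ↔ i < k ∧ p i < p k := by
  simp [smallerBefore]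

theorem mem_occurrences_pat213_iff {p : Equiv.Perm (Fin n)} (e : Fin 3 → Fin n) :
    e ∈ occurrences pat213 p ↔
      e 0 < e 1 ∧ e 1 < e 2 ∧ p (e 1) < p (e 0) ∧ p (e 0) < p (e 2) := by
  simp only [occurrences, mem_filter, mem_univ, true_and]
  constructor
  · rintro ⟨hpos, hval⟩
    exact ⟨hpos _ _ (by decide), hpos _ _ (by decide), (hval _ _).2 (by decide),
      (hval _ _).2 (by decide)⟩
  · rintro ⟨h01, h12, hp10, hp02⟩
    have h02 := h01.trans h12
    have hp12 := hp10.trans hp02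
    have hpat0 : pat213 0 = 1 := by decide
    have hpat1 : pat213 1 = 0 := by decide
    have hpat2 : pat213 2 = 2 := by decide
    refine ⟨fun a b hab => ?_, fun a b => ?_⟩
    · fin_cases a <;> fin_cases b <;> simp_all
    · fin_cases a <;> fin_cases b <;> simp [*, le_of_lt]

/-- Avoiding `123` forces the smaller entries to the left of a given one into decreasing order, so
any two of them form a `213` with it. -/
theorem num_pat213_eq_sum_choose {p : Equiv.Perm (Fin n)} (hp : Avoids pat123 p) :
    num pat213 p = ∑ k, (#(smallerBefore p k)).choose 2 := by
  rw [avoids_pat123_iff] at hp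
  simp_rw [← card_product_filter_lt, num, ← card_sigma]
  refine card_bij' (fun e _ => ⟨e 2, (e 0, e 1)⟩) (fun x _ => ![x.2.1, x.2.2, x.1]) ?_ ?_ ?_ ?_
  · intro e he
    obtain ⟨h01, h12, hp10, hp02⟩ := (mem_occurrences_pat213_iff e).1 he
    simp only [mem_sigma, mem_univ, mem_filter, mem_product, mem_smallerBefore, true_and]
    exact ⟨⟨⟨h01.trans h12, hp02⟩, h12, hp10.trans hp02⟩, h01⟩
  · rintro ⟨k, i, j⟩ hx
    simp only [mem_sigma, mem_univ, mem_filter, mem_product, mem_smallerBefore, true_and] at hx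
    obtain ⟨⟨⟨-, hpik⟩, hjk, hpjk⟩, hij⟩ := hx
    have hpji : p j < p i := (not_lt.1 fun hpij => hp i j k hij hjk hpij hpjk).lt_of_ne
      (p.injective.ne hij.ne')
    exact (mem_occurrences_pat213_iff _).2 ⟨hij, hjk, hpji, hpik⟩
  · intro e _
    ext a
    fin_cases a <;> rfl
  · exact fun _ _ => rfl

theorem card_smallerBefore_snocPerm_castSucc (v : Fin (n + 1)) (q : Equiv.Perm (Fin n))
    (k : Fin n) : #(smallerBefore (snocPerm v q) k.castSucc) = #(smallerBefore q k) := by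
  rw [← card_map (Fin.castSuccEmb (n := n))]
  congr 1
  ext i
  induction i using Fin.lastCases with
  | last => simp [mem_smallerBefore, (Fin.castSucc_lt_last _).le]
  | cast i => simp [mem_smallerBefore]

theorem card_smallerBefore_snocPerm_last (v : Fin (n + 1)) (q : Equiv.Perm (Fin n)) :
    #(smallerBefore (snocPerm v q) (Fin.last n)) = v := by
  have hmap : smallerBefore (snocPerm v q) (Fin.last n) =
      (Iio v).map (snocPerm v q).symm.toEmbedding := by
    ext i
    induction i using Fin.lastCases with
    | last => simp [mem_smallerBefore, mem_map_equiv]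
    | cast i => simp [mem_smallerBefore, mem_map_equiv, Fin.castSucc_lt_last]
  rw [hmap, card_map, Fin.card_Iio]

theorem num_pat213_snocPerm {v : Fin (n + 1)} {q : Equiv.Perm (Fin n)}
    (h : Avoids pat123 (snocPerm v q)) :
    num pat213 (snocPerm v q) = num pat213 q + (v : ℕ).choose 2 := by
  rw [num_pat213_eq_sum_choose h,
    num_pat213_eq_sum_choose ((avoids_pat123_snocPerm_iff v q).1 h).1, Fin.sum_univ_castSucc]
  simp only [card_smallerBefore_snocPerm_castSucc, card_smallerBefore_snocPerm_last]

end Avoidance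

section Cuts

variable {n : ℕ}

/-- Each of the first `k` entries of `p` is larger than each of the remaining ones. -/
def IsSkewCut (p : Equiv.Perm (Fin n)) (k : ℕ) : Prop :=
  ∀ i j : Fin n, (i : ℕ) < k → k ≤ (j : ℕ) → p j < p i

/-- `p` has a nonempty prefix, possibly all of `p`, whose entries are larger than the remaining ones
and at least `h`: exactly then appending an entry `h` makes `p` decomposable. -/
def HasSkewCutGE (p : Equiv.Perm (Fin n)) (h : ℕ) : Prop :=
  ∃ k ≤ n, 0 < k ∧ IsSkewCut p k ∧ ∀ i : Fin n, (i : ℕ) < k → h ≤ p i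

theorem isSkewCut_snocPerm_iff {k : ℕ} (hk : k ≤ n) (v : Fin (n + 1)) (q : Equiv.Perm (Fin n)) :
    IsSkewCut (snocPerm v q) k ↔ IsSkewCut q k ∧ ∀ i : Fin n, (i : ℕ) < k → (v : ℕ) ≤ q i := by
  simp only [IsSkewCut, Fin.forall_fin_succ', Fin.val_castSucc, Fin.val_last, hk, hk.not_gt,
    snocPerm_last, lt_snocPerm_castSucc_iff, snocPerm_castSucc_lt_castSucc_iff, false_imp_iff,
    true_imp_iff, and_true, imp_true_iff]
  simp only [forall_and]

theorem decomposable_snocPerm_iff (v : Fin (n + 1)) (q : Equiv.Perm (Fin n)) :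
    Decomposable (snocPerm v q) ↔ HasSkewCutGE q v := by
  refine exists_congr fun k => ?_
  rw [Nat.lt_succ_iff]
  exact and_congr_right fun hk => and_congr_right fun _ => isSkewCut_snocPerm_iff hk v q

theorem hasSkewCutGE_one_iff (hn : 0 < n) (p : Equiv.Perm (Fin n)) :
    HasSkewCutGE p 1 ↔ Decomposable p := by
  constructor
  · rintro ⟨k, hkn, hk, hcut, hge⟩
    refine ⟨k, ?_, hk, hcut⟩
    by_contra! hnk
    simpa using hge (p.symm ⟨0, hn⟩) (by omega)
  · rintro ⟨k, hkn, hk, hcut⟩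
    exact ⟨k, hkn.le, hk, hcut, fun i hi => (Nat.zero_le _).trans_lt (hcut i ⟨k, hkn⟩ hi le_rfl)⟩

theorem hasSkewCutGE_succ_snocPerm_iff (v : Fin (n + 1)) (q : Equiv.Perm (Fin n)) (h : ℕ) :
    HasSkewCutGE (snocPerm v q) (h + 1) ↔ ∃ k ≤ n, 0 < k ∧ IsSkewCut q k ∧
      ∀ i : Fin n, (i : ℕ) < k → (v : ℕ) ≤ q i ∧ h + 1 ≤ (snocPerm v q i.castSucc : ℕ) := by
  constructor
  · rintro ⟨k, -, hk, hcut, hge⟩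
    have hkn : k ≤ n := by
      by_contra! hnk
      simpa using hge ((snocPerm v q).symm 0) (by omega)
    obtain ⟨hq, hv⟩ := (isSkewCut_snocPerm_iff hkn v q).1 hcut
    exact ⟨k, hkn, hk, hq, fun i hi => ⟨hv i hi, hge i.castSucc hi⟩⟩
  · rintro ⟨k, hkn, hk, hq, hge⟩
    refine ⟨k, by omega, hk, (isSkewCut_snocPerm_iff hkn v q).2 ⟨hq, fun i hi => (hge i hi).1⟩, ?_⟩
    intro i hi
    induction i using Fin.lastCases with
    | last => exact absurd hi hkn.not_gt
    | cast i => exact (hge i hi).2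

theorem hasSkewCutGE_snocPerm_zero_iff (q : Equiv.Perm (Fin n)) (h : ℕ) :
    HasSkewCutGE (snocPerm 0 q) (h + 1) ↔ HasSkewCutGE q h := by
  rw [hasSkewCutGE_succ_snocPerm_iff]
  simp [HasSkewCutGE]

theorem hasSkewCutGE_snocPerm_iff {v : Fin (n + 1)} {h : ℕ} (hv : h < v)
    (q : Equiv.Perm (Fin n)) : HasSkewCutGE (snocPerm v q) (h + 1) ↔ HasSkewCutGE q v := by
  rw [hasSkewCutGE_succ_snocPerm_iff, HasSkewCutGE]
  have hge (i : Fin n) (hi : (v : ℕ) ≤ q i) : h + 1 ≤ (snocPerm v q i.castSucc : ℕ) :=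
    Nat.succ_le_of_lt (hv.trans ((lt_snocPerm_castSucc_iff v q i).2 hi))
  simp +contextual only [and_iff_left_of_imp (hge _)]

end Cuts

theorem mem_indecAv123_iff {n : ℕ} {p : Equiv.Perm (Fin n)} :
    p ∈ indecAv123 n ↔ Avoids pat123 p ∧ ¬ Decomposable p :=
  mem_filter_univ p

/-- The permutations that become indecomposable and `123`-avoiding when a last entry `h` is
appended. -/
def indecPrefixes (h n : ℕ) : Finset (Equiv.Perm (Fin n)) :=
  {q | ∃ hh : h < n + 1, snocPerm ⟨h, hh⟩ q ∈ indecAv123 (n + 1)}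

section Prefixes

variable {n : ℕ}

theorem mem_indecPrefixes_iff {h : ℕ} {q : Equiv.Perm (Fin n)} :
    q ∈ indecPrefixes h n ↔ h ≤ n ∧ Avoids pat123 q ∧ AscentTopsGE q h ∧ ¬ HasSkewCutGE q h := by
  simp only [indecPrefixes, mem_filter_univ, mem_indecAv123_iff, avoids_pat123_snocPerm_iff,
    decomposable_snocPerm_iff, exists_prop, Nat.lt_succ_iff, and_assoc]

theorem indecPrefixes_one (hn : 0 < n) : indecPrefixes 1 n = indecAv123 n := by
  ext q
  have htops : AscentTopsGE q 1 := fun i j _ hlt => (Nat.zero_le _).trans_lt hlt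
  simp [mem_indecPrefixes_iff, mem_indecAv123_iff, hasSkewCutGE_one_iff hn, htops,
    Nat.succ_le_iff.2 hn]

theorem indecPrefixes_zero_succ : indecPrefixes 0 (n + 1) = ∅ := by
  refine eq_empty_of_forall_notMem fun q hq => (mem_indecPrefixes_iff.1 hq).2.2.2 ?_
  exact ⟨n + 1, le_rfl, n.succ_pos, fun i j _ hj => absurd j.2 hj.not_gt, fun _ _ => Nat.zero_le _⟩

theorem indecPrefixes_zero_zero : indecPrefixes 0 0 = univ := by
  ext q
  have hcut : ¬ HasSkewCutGE q 0 := fun ⟨k, hk, hk0, _⟩ => hk0.not_ge hk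
  simp [mem_indecPrefixes_iff, avoids_pat123_iff, AscentTopsGE, hcut, -univ_unique]

theorem indecPrefixes_eq_empty {h : ℕ} (hn : n < h) : indecPrefixes h n = ∅ :=
  eq_empty_of_forall_notMem fun _ hq => hn.not_ge (mem_indecPrefixes_iff.1 hq).1

theorem snocPerm_zero_mem_indecPrefixes_succ_iff {h : ℕ} {q : Equiv.Perm (Fin n)} :
    snocPerm 0 q ∈ indecPrefixes (h + 1) (n + 1) ↔ q ∈ indecPrefixes h n := by
  have htops : AscentTopsGE q 0 := fun _ _ _ _ => Nat.zero_le _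
  simp [mem_indecPrefixes_iff, avoids_pat123_snocPerm_iff, ascentTopsGE_snocPerm_zero_iff,
    hasSkewCutGE_snocPerm_zero_iff, htops]

theorem snocPerm_mem_indecPrefixes_succ_iff {h : ℕ} {v : Fin (n + 1)} {q : Equiv.Perm (Fin n)}
    (hv : 0 < (v : ℕ)) :
    snocPerm v q ∈ indecPrefixes (h + 1) (n + 1) ↔ h < v ∧ q ∈ indecPrefixes v n := by
  have hvn : (v : ℕ) ≤ n := Nat.lt_succ_iff.1 v.2
  simp only [mem_indecPrefixes_iff, avoids_pat123_snocPerm_iff]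
  constructor
  · rintro ⟨-, ⟨hav, htops⟩, htops', hcut⟩
    have hhv := (ascentTopsGE_snocPerm_iff hv htops).1 htops'
    exact ⟨hhv, hvn, hav, htops, (hasSkewCutGE_snocPerm_iff hhv q).not.1 hcut⟩
  · rintro ⟨hhv, -, hav, htops, hcut⟩
    exact ⟨by omega, ⟨hav, htops⟩, (ascentTopsGE_snocPerm_iff hv htops).2 hhv,
      (hasSkewCutGE_snocPerm_iff hhv q).not.2 hcut⟩

end Prefixes

section Sums

variable {n : ℕ} {M : Type*} [AddCommMonoid M]

theorem sum_indecPrefixes_succ {w : Equiv.Perm (Fin (n + 1)) → M} {w' : Equiv.Perm (Fin n) → M}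
    {c : ℕ → M} (hc : c 0 = 0)
    (hw : ∀ v q, Avoids pat123 (snocPerm v q) → w (snocPerm v q) = w' q + c v) (h : ℕ) :
    ∑ p ∈ indecPrefixes (h + 1) (n + 1), w p = ∑ q ∈ indecPrefixes h n, w' q +
      ∑ v ∈ Ico h n, ∑ q ∈ indecPrefixes (v + 1) n, (w' q + c (v + 1)) := by
  have hw' (v q) (hvq : snocPerm v q ∈ indecPrefixes (h + 1) (n + 1)) :
      w (snocPerm v q) = w' q + c v := hw v q (mem_indecPrefixes_iff.1 hvq).2.1
  have hzero : ∑ q with snocPerm 0 q ∈ indecPrefixes (h + 1) (n + 1), w (snocPerm 0 q) =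
      ∑ q ∈ indecPrefixes h n, w' q :=
    sum_congr (by ext; simp [snocPerm_zero_mem_indecPrefixes_succ_iff]) fun q hq => by
      rw [hw' 0 q (snocPerm_zero_mem_indecPrefixes_succ_iff.2 hq), Fin.val_zero, hc, add_zero]
  have hsucc (v : Fin n) :
      ∑ q with snocPerm v.succ q ∈ indecPrefixes (h + 1) (n + 1), w (snocPerm v.succ q) =
        if h ≤ v then ∑ q ∈ indecPrefixes (v + 1) n, (w' q + c (v + 1)) else 0 := by
    rw [sum_congr rfl fun q hq => hw' v.succ q ((mem_filter_univ q).1 hq)]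
    simp only [snocPerm_mem_indecPrefixes_succ_iff v.succ_pos, Fin.val_succ, Nat.lt_succ_iff]
    split_ifs with hv <;> simp [hv]
  rw [← filter_univ_mem (indecPrefixes (h + 1) (n + 1)), sum_filter,
    ← (snocPerm_bijective n).sum_comp, Fintype.sum_prod_type, Fin.sum_univ_succ]
  simp only [← sum_filter]
  simp only [hzero, hsucc]
  rw [Fin.sum_univ_eq_sum_range fun v =>
      if h ≤ v then ∑ q ∈ indecPrefixes (v + 1) n, (w' q + c (v + 1)) else 0,
    ← sum_filter, range_eq_Ico, Ico_filter_le, max_eq_right h.zero_le]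

theorem sum_indecPrefixes_succ_eq_add {w : Equiv.Perm (Fin (n + 1)) → M}
    {w' : Equiv.Perm (Fin n) → M} {c : ℕ → M} (hc : c 0 = 0)
    (hw : ∀ v q, Avoids pat123 (snocPerm v q) → w (snocPerm v q) = w' q + c v) (h : ℕ) :
    ∑ p ∈ indecPrefixes (h + 1) (n + 1), w p = ∑ p ∈ indecPrefixes (h + 2) (n + 1), w p +
      ∑ q ∈ indecPrefixes h n, w' q + #(indecPrefixes (h + 1) n) • c (h + 1) := by
  rw [sum_indecPrefixes_succ hc hw, sum_indecPrefixes_succ hc hw]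
  rcases lt_or_ge h n with hn | hn
  · rw [sum_eq_sum_Ico_succ_bot hn, sum_add_distrib, sum_const]
    abel
  · simp [indecPrefixes_eq_empty (Nat.lt_succ_of_le hn), Ico_eq_empty_of_le hn,
      Ico_eq_empty_of_le (Nat.le_succ_of_le hn)]

end Sums

theorem num_eq_zero_of_lt {k n : ℕ} (hnk : n < k) (q : Equiv.Perm (Fin k))
    (p : Equiv.Perm (Fin n)) : num q p = 0 := by
  refine card_eq_zero.2 (filter_eq_empty_iff.2 fun e _ he => hnk.not_ge ?_)
  simpa using Fintype.card_le_of_injective e (StrictMono.injective fun i j => he.1 i j)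

/-- The generating function, by length, of the permutations in `indecPrefixes h`. -/
noncomputable def prefixSeries (h : ℕ) : ℚ⟦X⟧ :=
  PowerSeries.mk fun n => (#(indecPrefixes h n) : ℚ)

/-- The generating function, by length, of the total number of `213` patterns in the permutations
of `indecPrefixes h`. -/
noncomputable def prefixPatternSeries (h : ℕ) : ℚ⟦X⟧ :=
  PowerSeries.mk fun n => (totalNum pat213 (indecPrefixes h n) : ℚ)

theorem prefixSeries_zero : prefixSeries 0 = 1 := by
  ext n
  cases n <;> simp [prefixSeries, indecPrefixes_zero_zero, indecPrefixes_zero_succ, coeff_one]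

theorem prefixPatternSeries_zero : prefixPatternSeries 0 = 0 := by
  ext n
  cases n <;> simp [prefixPatternSeries, totalNum, indecPrefixes_zero_succ, num_eq_zero_of_lt]

theorem prefixPatternSeries_one : prefixPatternSeries 1 = genFun213 := by
  ext n
  cases n <;> simp [prefixPatternSeries, genFun213, totalNum, num_eq_zero_of_lt, indecPrefixes_one]

theorem X_pow_dvd_prefixSeries (h : ℕ) : X ^ h ∣ prefixSeries h :=
  X_pow_dvd_iff.2 fun n hn => by simp [prefixSeries, indecPrefixes_eq_empty hn]

theorem X_pow_dvd_prefixPatternSeries (h : ℕ) : X ^ h ∣ prefixPatternSeries h :=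
  X_pow_dvd_iff.2 fun n hn => by simp [prefixPatternSeries, totalNum, indecPrefixes_eq_empty hn]

theorem prefixSeries_succ (h : ℕ) :
    prefixSeries (h + 1) = prefixSeries (h + 2) + X * prefixSeries h := by
  ext n
  cases n with
  | zero => simp [prefixSeries, indecPrefixes_eq_empty]
  | succ n =>
    have hsum := sum_indecPrefixes_succ_eq_add (n := n) (w := 1) (w' := 1)
      (c := (0 : ℕ → ℕ)) rfl (fun _ _ _ => rfl) h
    simp only [Pi.one_apply, Pi.zero_apply, sum_const, smul_eq_mul, mul_one, mul_zero,
      add_zero] at hsum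
    simp only [prefixSeries, map_add, coeff_succ_X_mul, coeff_mk]
    exact_mod_cast hsum

theorem prefixPatternSeries_succ (h : ℕ) :
    prefixPatternSeries (h + 1) = prefixPatternSeries (h + 2) + X * prefixPatternSeries h +
      X * (((h + 1).choose 2 : ℚ⟦X⟧) * prefixSeries (h + 1)) := by
  ext n
  cases n with
  | zero => simp [prefixPatternSeries, totalNum, indecPrefixes_eq_empty]
  | succ n =>
    have hsum := sum_indecPrefixes_succ_eq_add (n := n) (c := fun v => v.choose 2) rfl
      (fun _ _ hvq => num_pat213_snocPerm hvq) h
    simp only [prefixPatternSeries, prefixSeries, totalNum, map_add, coeff_succ_X_mul, coeff_mk,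
      ← nsmul_eq_mul, map_nsmul]
    simp only [nsmul_eq_mul]
    rw [mul_comm ((Nat.choose _ _ : ℕ) : ℚ)]
    exact_mod_cast hsum

theorem eq_of_X_pow_dvd_of_eq_mul_succ_add {R : Type*} [CommRing R] {D E G : ℕ → R⟦X⟧}
    {c : R⟦X⟧} (hD : ∀ h, X ^ h ∣ D h) (hE : ∀ h, X ^ h ∣ E h)
    (hDG : ∀ h, D h = c * D (h + 1) + G h) (hEG : ∀ h, E h = c * E (h + 1) + G h) (h : ℕ) :
    D h = E h := by
  have hpow (k : ℕ) : D h - E h = c ^ k * (D (h + k) - E (h + k)) := by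
    induction k with
    | zero => simp
    | succ k ih =>
      rw [ih, ← add_assoc]
      linear_combination c ^ k * (hDG (h + k) - hEG (h + k))
  ext k
  have hXk : X ^ (k + 1) ∣ D h - E h := by
    rw [hpow (k + 1)]
    exact (pow_dvd_pow X (by omega)).trans ((dvd_sub (hD _) (hE _)).mul_left _)
  exact sub_eq_zero.1 ((map_sub _ _ _).symm.trans (X_pow_dvd_iff.1 hXk k k.lt_succ_self))

theorem catalanGF_eq : catalanGF = 1 + X * catalanGF ^ 2 := by
  simpa [catalanGF, add_comm, mul_comm] using
    (congrArg (PowerSeries.map (Nat.castRingHom ℚ)) catalanSeries_sq_mul_X_add_one).symm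

theorem constantCoeff_catalanGF : constantCoeff catalanGF = 1 := by
  rw [catalanGF_eq]
  simp

theorem sub_X_mul_catalanGF_mul_eq {F G : ℕ → ℚ⟦X⟧}
    (hF : ∀ h, F (h + 1) = F (h + 2) + X * F h + X * G h) (h : ℕ) :
    F (h + 1) - X * catalanGF * F h =
      catalanGF * (F (h + 2) - X * catalanGF * F (h + 1)) + X * catalanGF * G h := by
  linear_combination catalanGF * hF h - F (h + 1) * catalanGF_eq

theorem X_pow_dvd_sub_X_mul_catalanGF_mul {F : ℕ → ℚ⟦X⟧} (hF : ∀ h, X ^ h ∣ F h) (h : ℕ) :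
    X ^ h ∣ F (h + 1) - X * catalanGF * F h :=
  dvd_sub ((pow_dvd_pow X h.le_succ).trans (hF _)) ((hF h).mul_left _)

theorem prefixSeries_eq_pow (h : ℕ) : prefixSeries h = (X * catalanGF) ^ h := by
  have hstep (h : ℕ) : prefixSeries (h + 1) - X * catalanGF * prefixSeries h = 0 :=
    eq_of_X_pow_dvd_of_eq_mul_succ_add (c := catalanGF) (G := 0) (E := 0)
      (X_pow_dvd_sub_X_mul_catalanGF_mul X_pow_dvd_prefixSeries) (fun _ => dvd_zero _)
      (fun h => by
        simpa using sub_X_mul_catalanGF_mul_eq (G := 0) (by simpa using prefixSeries_succ) h)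
      (fun _ => by simp) h
  induction h with
  | zero => rw [prefixSeries_zero, pow_zero]
  | succ h ih => rw [sub_eq_zero.1 (hstep h), ih, pow_succ']

/-- The numerator of `∑ i, choose (h + i) 2 * y ^ i` over the denominator `(1 - y) ^ 3`. -/
def chooseTwoTail {R : Type*} [CommRing R] (y : R) (h : ℕ) : R :=
  h.choose 2 * (1 - y) ^ 2 + h * y * (1 - y) + y ^ 2

theorem chooseTwoTail_eq {R : Type*} [CommRing R] (y : R) (h : ℕ) :
    chooseTwoTail y h = h.choose 2 * (1 - y) ^ 3 + y * chooseTwoTail y (h + 1) := by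
  have hchoose : (h + 1).choose 2 = h + h.choose 2 := by
    rw [Nat.choose_succ_succ', Nat.choose_one_right]
  simp only [chooseTwoTail, hchoose]
  push_cast
  ring

theorem chooseTwoTail_one {R : Type*} [CommRing R] (y : R) : chooseTwoTail y 1 = y := by
  simp only [chooseTwoTail, Nat.choose_eq_zero_of_lt one_lt_two, Nat.cast_zero, Nat.cast_one]
  ring

theorem one_sub_pow_three_mul_prefixPatternSeries (h : ℕ) :
    (1 - X * catalanGF ^ 2) ^ 3 *
        (prefixPatternSeries (h + 1) - X * catalanGF * prefixPatternSeries h) =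
      (X * catalanGF) ^ (h + 2) * chooseTwoTail (X * catalanGF ^ 2) (h + 1) := by
  revert h
  refine eq_of_X_pow_dvd_of_eq_mul_succ_add (c := catalanGF)
    (G := fun h => (1 - X * catalanGF ^ 2) ^ 3 *
      (((h + 1).choose 2 : ℚ⟦X⟧) * (X * catalanGF) ^ (h + 2)))
    (fun h => ?_) (fun h => ?_) (fun h => ?_) (fun h => ?_)
  · exact (X_pow_dvd_sub_X_mul_catalanGF_mul X_pow_dvd_prefixPatternSeries h).mul_left _
  · rw [mul_pow]
    exact ((pow_dvd_pow X (by omega)).mul_right _).mul_right _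
  · have hker := sub_X_mul_catalanGF_mul_eq prefixPatternSeries_succ h
    rw [prefixSeries_eq_pow] at hker
    linear_combination (1 - X * catalanGF ^ 2) ^ 3 * hker
  · linear_combination (X * catalanGF) ^ (h + 2) * chooseTwoTail_eq (X * catalanGF ^ 2) (h + 1)

theorem oneSubFourXPow_add (a b : ℚ) :
    oneSubFourXPow (a + b) = oneSubFourXPow a * oneSubFourXPow b := by
  simp [oneSubFourXPow]

theorem oneSubFourXPow_zero : oneSubFourXPow 0 = 1 := by
  simp [oneSubFourXPow]

theorem oneSubFourXPow_one : oneSubFourXPow 1 = 1 - 4 * X := by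
  have hbinom := binomialSeries_nat (R := ℚ) (A := ℚ) 1
  rw [Nat.cast_one, pow_one] at hbinom
  rw [oneSubFourXPow, hbinom, map_add, map_one, rescale_X, map_neg, map_ofNat, neg_mul,
    sub_eq_add_neg]

theorem constantCoeff_oneSubFourXPow (a : ℚ) : constantCoeff (oneSubFourXPow a) = 1 := by
  rw [← coeff_zero_eq_constantCoeff_apply, oneSubFourXPow, coeff_rescale]
  simp

theorem oneSubFourXPow_neg (a : ℚ) : oneSubFourXPow (-a) = (oneSubFourXPow a)⁻¹ := by
  rw [PowerSeries.eq_inv_iff_mul_eq_one (by simp [constantCoeff_oneSubFourXPow]),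
    ← oneSubFourXPow_add, neg_add_cancel, oneSubFourXPow_zero]

theorem oneSubFourXPow_half : oneSubFourXPow (1 / 2) = 1 - 2 * X * catalanGF := by
  have hsq : oneSubFourXPow (1 / 2) ^ 2 = (1 - 2 * X * catalanGF) ^ 2 := by
    rw [sq, ← oneSubFourXPow_add, add_halves, oneSubFourXPow_one]
    linear_combination 4 * X * catalanGF_eq
  refine (sq_eq_sq_iff_eq_or_eq_neg.1 hsq).resolve_right fun hneg => ?_
  have hcoeff := congrArg constantCoeff hneg
  norm_num [constantCoeff_oneSubFourXPow] at hcoeff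

theorem oneSubFourXPow_three_halves :
    oneSubFourXPow (3 / 2) = (1 - 2 * X * catalanGF) ^ 3 := by
  rw [← oneSubFourXPow_half, pow_three, ← oneSubFourXPow_add, ← oneSubFourXPow_add]
  norm_num

theorem genFun213_mul_oneSubFourXPow :
    genFun213 * oneSubFourXPow (3 / 2) = X ^ 3 * catalanGF := by
  have hC : catalanGF ^ 3 ≠ 0 := pow_ne_zero 3 fun hzero => by
    simpa [hzero] using constantCoeff_catalanGF
  have hroot : catalanGF * (1 - 2 * X * catalanGF) = 1 - X * catalanGF ^ 2 := by
    linear_combination catalanGF_eq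
  have hgen := one_sub_pow_three_mul_prefixPatternSeries 0
  rw [prefixPatternSeries_zero, zero_add, prefixPatternSeries_one, chooseTwoTail_one,
    ← hroot] at hgen
  rw [oneSubFourXPow_three_halves]
  refine mul_left_cancel₀ hC ?_
  linear_combination hgen

theorem two_mul_genFun213 :
    2 * genFun213 = X ^ 2 * (oneSubFourXPow (3 / 2))⁻¹ - X ^ 2 * (1 - 4 * X)⁻¹ := by
  have hgen : genFun213 = X ^ 3 * catalanGF * oneSubFourXPow (-(3 / 2)) := by
    rw [oneSubFourXPow_neg, PowerSeries.eq_mul_inv_iff_mul_eq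
      (by simp [constantCoeff_oneSubFourXPow]), genFun213_mul_oneSubFourXPow]
  have hadd : oneSubFourXPow (-1) = oneSubFourXPow (1 / 2) * oneSubFourXPow (-(3 / 2)) := by
    rw [← oneSubFourXPow_add]
    norm_num
  rw [hgen, ← oneSubFourXPow_one, ← oneSubFourXPow_neg, ← oneSubFourXPow_neg, hadd,
    oneSubFourXPow_half]
  ring

theorem succ_mul_ringChoose_succ {R : Type*} [CommRing R] [BinomialRing R] (r : R) (k : ℕ) :
    ((k : R) + 1) * Ring.choose r (k + 1) = (r - k) * Ring.choose r k := by
  have hmul := Ring.choose_smul_choose r k.le_succ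
  rw [Nat.succ_eq_add_one, Nat.choose_succ_self_right, Nat.add_sub_cancel_left,
    Ring.choose_one_right, nsmul_eq_mul] at hmul
  push_cast at hmul
  linear_combination hmul

theorem coeff_oneSubFourXPow_neg_three_halves (m : ℕ) :
    coeff m (oneSubFourXPow (-(3 / 2))) = (2 * m + 1) * (m.centralBinom : ℚ) := by
  rw [oneSubFourXPow, coeff_rescale, binomialSeries_coeff, smul_eq_mul, mul_one]
  induction m with
  | zero => simp
  | succ m ih =>
    have hbinom : ((m : ℚ) + 1) * ((m + 1).centralBinom : ℚ) =
        2 * (2 * m + 1) * (m.centralBinom : ℚ) := by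
      exact_mod_cast Nat.succ_mul_centralBinom_succ m
    have hchoose := succ_mul_ringChoose_succ (-(3 / 2) : ℚ) m
    apply mul_left_cancel₀ (Nat.cast_add_one_ne_zero (R := ℚ) m)
    push_cast
    linear_combination (-4) ^ (m + 1) * hchoose + (4 * m + 6) * ih - (2 * m + 3) * hbinom

theorem coeff_inv_one_sub_four_mul_X (m : ℕ) : coeff m (1 - 4 * X : ℚ⟦X⟧)⁻¹ = 4 ^ m := by
  have hgeom := congrArg (rescale (4 : ℚ)) (mk_one_mul_one_sub_eq_one ℚ)
  rw [map_mul, map_sub, map_one, rescale_X, map_ofNat,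
    ← PowerSeries.eq_inv_iff_mul_eq_one (by simp)] at hgeom
  rw [← hgeom, coeff_rescale, coeff_mk, Pi.one_apply, mul_one]

end PatternCount

open PatternCount in
theorem mainTheorem2 :
    PatternCount.genFun213 =
        PowerSeries.X ^ 3 * PatternCount.catalanGF * (PatternCount.oneSubFourXPow (3 / 2))⁻¹ ∧
    PatternCount.genFun213 =
        PowerSeries.X ^ 2 * (2 * PatternCount.oneSubFourXPow (3 / 2))⁻¹ -
          PowerSeries.X ^ 2 * (2 * (1 - 4 * PowerSeries.X))⁻¹ ∧
    ∀ m : ℕ, (PatternCount.totalNum PatternCount.pat213 (PatternCount.indecAv123 (m + 2)) : ℚ) =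
        (2 * (m : ℚ) + 1) / 2 * (Nat.choose (2 * m) m : ℚ) - 4 ^ m / 2 := by
  refine ⟨?_, ?_, fun m => ?_⟩
  · rw [PowerSeries.eq_mul_inv_iff_mul_eq (by simp [constantCoeff_oneSubFourXPow]),
      genFun213_mul_oneSubFourXPow]
  · have htwo : (2 : PowerSeries ℚ) * 2⁻¹ = 1 :=
      PowerSeries.mul_inv_cancel _ (by rw [map_ofNat]; exact two_ne_zero)
    rw [PowerSeries.mul_inv_rev, PowerSeries.mul_inv_rev]
    linear_combination 2⁻¹ * two_mul_genFun213 - genFun213 * htwo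
  · have hcoeff := congrArg (PowerSeries.coeff (m + 2)) two_mul_genFun213
    rw [two_mul, map_add, map_sub, PowerSeries.coeff_X_pow_mul, PowerSeries.coeff_X_pow_mul,
      ← oneSubFourXPow_neg, coeff_oneSubFourXPow_neg_three_halves, coeff_inv_one_sub_four_mul_X,
      genFun213, PowerSeries.coeff_mk, Nat.centralBinom_eq_two_mul_choose] at hcoeff
    linear_combination hcoeff / 2
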